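/- All spaces are Tychonoff (completely regular Hausdorff). A space $T$ is \emph{realcompact} if every family of closed subsets of $T$ which has the finite intersection property and is stable (every $g\in C(T)$ is bounded on some member of the family) has non-empty intersection. A subset of a space is called realcompact or pseudocompact if it is so as a subspace. A set $H\subseteq X$ is \emph{hard} in $X$ if $H$ is closed in $X$ and there is a compact set $K\subseteq X$ such that for every open $V\supseteq K$ there is a realcompact set $P\subseteq X$ for which $H\setminus V$ and $X\setminus P$ are completely separated, i.e. some continuous $g:X\to[0,1]$ is $0$ on $H\setminus V$ and $1$ on $X\setminus P$. A \emph{hard map} is a continuous map that sends hard sets to hard sets. A space $Y$ is \emph{nearly pseudocompact} if $Y=Y_1\cup Y_2$, where $Y_1$ is regular closed, pseudocompact, and equal to the closure in $Y$ of the set of all points of $Y$ having a compact neighbourhood; $Y_2$ is regular closed and anti-locally realcompact (no point of the subspace $Y_2$ has a realcompact neighbourhood in $Y_2$); and $\operatorname{int}_Y(Y_1\cap Y_2)=\emptyset$. An \emph{$hz$-filter} on $X$ is a $z$-filter on $X$ having a base of hard zero sets of $X$, and an \emph{$hz$-ultrafilter} is a maximal $hz$-filter. Let $\delta X$ be the set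 of all fixed $z$-ultrafilters and all $hz$-ultrafilters on $X$, with the topology for which the sets $\{p\in\delta X: Z\in p\}$, with $Z$ a zero set of $X$, form a base for the closed sets. A point $x\in X$ is identified with the fixed $z$-ultrafilter $A_x=\{Z : Z \text{ a zero set of } X,\ x\in Z\}\in\delta X$. \textbf{Statement.} Let $f:X\to Y$ be a hard map from a space $X$ to a nearly pseudocompact space $Y$. Then there is exactly one continuous map $f^*:\delta X\to Y$ that extends $f$, that is, such that $f^*(A_x)=f(x)$ for all $x\in X$. -/

import Mathlib

open Set Topology

namespace HardSets

universe u v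

/-- A family of closed sets of `X` is stable if every real-valued continuous function on `X`
is bounded on some member of the family. -/
def IsStable {X : Type u} [TopologicalSpace X] (S : Set (Set X)) : Prop :=
  ∀ f : C(X, ℝ), ∃ F ∈ S, ∃ M : ℝ, ∀ x ∈ F, |f x| ≤ M

/-- The finite intersection property. -/
def HasFIP {X : Type u} (S : Set (Set X)) : Prop :=
  ∀ T : Finset (Set X), (T : Set (Set X)) ⊆ S → (⋂₀ (T : Set (Set X))).Nonempty

/-- A space is realcompact if every stable family of closed sets with the finite intersection
property is fixed, that is, has a nonempty intersection. -/
def RealcompactSpace (X : Type u) [TopologicalSpace X] : Prop :=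
  ∀ S : Set (Set X), (∀ F ∈ S, IsClosed F) → IsStable S → HasFIP S → (⋂₀ S).Nonempty

/-- A subset is realcompact if it is a realcompact space in the subspace topology. -/
def IsRealcompact {X : Type u} [TopologicalSpace X] (P : Set X) : Prop :=
  RealcompactSpace P

/-- A space is pseudocompact if every real-valued continuous function on it is bounded. -/
def PseudocompactSpace (X : Type u) [TopologicalSpace X] : Prop :=
  ∀ f : C(X, ℝ), ∃ M : ℝ, ∀ x, |f x| ≤ M

/-- `A` and `B` are completely separated: some continuous `[0,1]`-valued function is `0` on `A`
and `1` on `B`. -/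
def CompletelySeparated {X : Type u} [TopologicalSpace X] (A B : Set X) : Prop :=
  ∃ f : C(X, ℝ), (∀ x, f x ∈ Icc (0 : ℝ) 1) ∧ (∀ x ∈ A, f x = 0) ∧ (∀ x ∈ B, f x = 1)

/-- `H` is hard in `X`: it is closed and there is a compact set `K` such that for each open
`V ⊇ K` the set `H \ V` is completely separated from the complement of a realcompact set. -/
def IsHard {X : Type u} [TopologicalSpace X] (H : Set X) : Prop :=
  IsClosed H ∧ ∃ K : Set X, IsCompact K ∧ ∀ V : Set X, IsOpen V → K ⊆ V →
    ∃ P : Set X, IsRealcompact P ∧ CompletelySeparated (H \ V) Pᶜ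

/-- A hard map is a continuous map that takes hard sets to hard sets. -/
def IsHardMap {X : Type u} {Y : Type v} [TopologicalSpace X] [TopologicalSpace Y]
    (f : X → Y) : Prop :=
  Continuous f ∧ ∀ H : Set X, IsHard H → IsHard (f '' H)

/-- A regular closed set is the closure of its interior. -/
def IsRegularClosed {X : Type u} [TopologicalSpace X] (A : Set X) : Prop :=
  closure (interior A) = A

/-- A subset of a space `X` is almost locally compact if it is the closure of the set of all
points of `X` that have a compact neighbourhood in `X`. -/
def IsAlmostLocallyCompact {X : Type u} [TopologicalSpace X] (A : Set X) : Prop :=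
  A = closure {x : X | ∃ N ∈ 𝓝 x, IsCompact N}

/-- A space is anti-locally realcompact if no point of it has a realcompact neighbourhood. -/
def AntiLocallyRealcompactSpace (X : Type u) [TopologicalSpace X] : Prop :=
  ∀ x : X, ∀ N ∈ 𝓝 x, ¬ IsRealcompact N

/-- A space `X` is nearly pseudocompact if `X = X₁ ∪ X₂` where `X₁` is regular closed, almost
locally compact and pseudocompact, `X₂` is regular closed and anti-locally realcompact, and
`X₁ ∩ X₂` has empty interior. -/
def NearlyPseudocompactSpace (X : Type u) [TopologicalSpace X] : Prop :=
  ∃ X₁ X₂ : Set X, X₁ ∪ X₂ = univ ∧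
    IsRegularClosed X₁ ∧ IsAlmostLocallyCompact X₁ ∧ PseudocompactSpace X₁ ∧
    IsRegularClosed X₂ ∧ AntiLocallyRealcompactSpace X₂ ∧
    interior (X₁ ∩ X₂) = ∅

/-- The zero sets of `X`. -/
def IsZeroSet {X : Type u} [TopologicalSpace X] (Z : Set X) : Prop :=
  ∃ f : C(X, ℝ), Z = {x | f x = 0}

/-- The (proper) `z`-filters on `X`. -/
structure IsZFilter {X : Type u} [TopologicalSpace X] (F : Set (Set X)) : Prop where
  isZeroSet : ∀ Z ∈ F, IsZeroSet Z
  univ_mem : univ ∈ F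
  empty_notMem : ∅ ∉ F
  inter_mem : ∀ Z ∈ F, ∀ W ∈ F, Z ∩ W ∈ F
  mem_of_superset : ∀ Z ∈ F, ∀ W, IsZeroSet W → Z ⊆ W → W ∈ F

/-- A `z`-ultrafilter is a maximal `z`-filter. -/
def IsZUltrafilter {X : Type u} [TopologicalSpace X] (F : Set (Set X)) : Prop :=
  Maximal IsZFilter F

/-- A family of sets is fixed if its intersection is nonempty. -/
def IsFixed {X : Type u} (F : Set (Set X)) : Prop := (⋂₀ F).Nonempty

/-- An `hz`-filter is a `z`-filter with a base consisting of hard zero sets. -/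
def IsHzFilter {X : Type u} [TopologicalSpace X] (F : Set (Set X)) : Prop :=
  IsZFilter F ∧ ∀ Z ∈ F, ∃ H ∈ F, IsHard H ∧ H ⊆ Z

/-- An `hz`-ultrafilter is a maximal `hz`-filter. -/
def IsHzUltrafilter {X : Type u} [TopologicalSpace X] (F : Set (Set X)) : Prop :=
  Maximal IsHzFilter F

/-- The points of `δX`: the fixed `z`-ultrafilters and the `hz`-ultrafilters on `X`. -/
def Delta (X : Type u) [TopologicalSpace X] : Type u :=
  {p : Set (Set X) // (IsZUltrafilter p ∧ IsFixed p) ∨ IsHzUltrafilter p}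

/-- The set `{p ∈ δX : Z ∈ p}`. -/
def Delta.basicClosed {X : Type u} [TopologicalSpace X] (Z : Set X) : Set (Delta X) :=
  {p | Z ∈ p.1}

/-- The topology of `δX`: the sets `{p : Z ∈ p}`, for `Z` a zero set of `X`, form a base for the
closed sets (this family is closed under finite unions, so that generating the topology by the
complements amounts to declaring the complements a base). -/
instance Delta.instTopologicalSpace (X : Type u) [TopologicalSpace X] :
    TopologicalSpace (Delta X) :=
  TopologicalSpace.generateFrom {U | ∃ Z : Set X, IsZeroSet Z ∧ U = (Delta.basicClosed Z)ᶜ}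

/-- The fixed `z`-ultrafilter `A_x` of all zero sets that contain `x`. -/
def pointFilter {X : Type u} [TopologicalSpace X] (x : X) : Set (Set X) :=
  {Z | IsZeroSet Z ∧ x ∈ Z}

theorem isZFilter_pointFilter {X : Type u} [TopologicalSpace X] (x : X) :
    IsZFilter (pointFilter x) where
  isZeroSet := fun _ h => h.1
  univ_mem := ⟨⟨0, by ext; simp⟩, mem_univ x⟩
  empty_notMem := fun h => h.2
  inter_mem := by
    rintro _ ⟨⟨f, rfl⟩, hf⟩ _ ⟨⟨g, rfl⟩, hg⟩
    refine ⟨⟨f * f + g * g, ?_⟩, hf, hg⟩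
    ext y
    simp only [mem_inter_iff, mem_ofPred_eq, ContinuousMap.add_apply, ContinuousMap.mul_apply]
    exact (mul_self_add_mul_self_eq_zero).symm
  mem_of_superset := fun _ h _ hW hZW => ⟨hW, hZW h.2⟩

theorem isZUltrafilter_pointFilter {X : Type u} [TopologicalSpace X] (x : X) :
    IsZUltrafilter (pointFilter x) := by
  refine ⟨isZFilter_pointFilter x, fun G hG hle Z hZ => ⟨hG.isZeroSet Z hZ, ?_⟩⟩
  by_contra hx
  obtain ⟨f, rfl⟩ := hG.isZeroSet Z hZ
  have hW : {y | f y = f x} ∈ G :=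
    hle ⟨⟨f - ContinuousMap.const X (f x), by ext; simp [sub_eq_zero]⟩, rfl⟩
  refine hG.empty_notMem ?_
  have he : {y | f y = 0} ∩ {y | f y = f x} = ∅ := by
    ext y
    simp only [mem_inter_iff, mem_ofPred_eq, mem_empty_iff_false, iff_false, not_and]
    intro h0 h1
    exact hx (h1.symm.trans h0)
  exact he ▸ hG.inter_mem _ hZ _ hW

/-- The canonical map `X → δX`, `x ↦ A_x`, through which `X` is regarded as a subspace of `δX`. -/
def Delta.of {X : Type u} [TopologicalSpace X] (x : X) : Delta X :=
  ⟨pointFilter x, Or.inl ⟨isZUltrafilter_pointFilter x, x, fun _ h => h.2⟩⟩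

end HardSets

/-! The crux is that hard sets of a nearly pseudocompact `Y` are compact
(`NearlyPseudocompactSpace.isCompact_of_isHard`). If `g` is `0` on `A` and `1` off a realcompact
`P`, then `{g < 1}` misses the anti-locally realcompact part, hence lies in the pseudocompact part.
Cutting off with `g` shows that every function on `P` is bounded on `A`, and realcompactness of `P`
then makes `A` compact. So `f` sends hard sets to compact sets. A non-fixed point `p` of `δX`
contains a hard set, whose compact image holds a limit of `p` along `f`; a fixed `p` has an obvious
limit. Primeness of z-ultrafilters and complete regularity of `Y` make any choice of limits
continuous; density of `X` in `δX` gives uniqueness. -/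

namespace HardSets

universe u v

/-! ### Compactness of hard sets in nearly pseudocompact spaces -/

section Compactness

variable {Y : Type u} [TopologicalSpace Y]

/-- Realcompactness passes to closed subspaces. -/
theorem RealcompactSpace.of_isClosedEmbedding {D : Type v} [TopologicalSpace D]
    (hY : RealcompactSpace Y) {j : D → Y} (hj : IsClosedEmbedding j) : RealcompactSpace D := by
  classical
  intro S hcl hst hfip
  -- Stability is used here only to make `S` nonempty, so that the common point found in `Y` lies in
  -- the range of `j`.
  obtain ⟨F₀, hF₀, -⟩ := hst 0
  obtain ⟨y, hy⟩ := hY ((fun F => j '' F) '' S)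
    (by rintro _ ⟨F, hF, rfl⟩; exact hj.isClosedMap F (hcl F hF))
    (by
      intro f
      obtain ⟨F, hF, M, hM⟩ := hst (f.comp ⟨j, hj.continuous⟩)
      refine ⟨_, ⟨F, hF, rfl⟩, M, ?_⟩
      rintro _ ⟨d, hd, rfl⟩
      exact hM d hd)
    (by
      intro T hT
      obtain ⟨T', hT', rfl⟩ := Finset.subset_set_image_iff.1 hT
      obtain ⟨d, hd⟩ := hfip T' hT'
      refine ⟨j d, ?_⟩
      simp only [Finset.coe_image, sInter_image, mem_iInter]
      exact fun F hF => ⟨d, hd F hF, rfl⟩)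
  obtain ⟨d, -, rfl⟩ := hy _ ⟨F₀, hF₀, rfl⟩
  refine ⟨d, fun F hF => ?_⟩
  obtain ⟨d', hd', he⟩ := hy _ ⟨F, hF, rfl⟩
  exact hj.injective he ▸ hd'

/-- A closed subset of `Y` that lies in a realcompact subset `P`, and on which each continuous
function on `P` is bounded, is compact. -/
theorem IsRealcompact.isCompact_of_bounded {P A : Set Y} (hP : IsRealcompact P)
    (hA : IsClosed A) (hAP : A ⊆ P)
    (hb : ∀ h : C(P, ℝ), ∃ M : ℝ, ∀ x : P, (x : Y) ∈ A → |h x| ≤ M) : IsCompact A := by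
  rw [isCompact_iff_ultrafilter_le_nhds]
  intro U hU
  have hAU : A ∈ U := Filter.le_principal_iff.1 hU
  have hPU : P ∈ U := Filter.mem_of_superset hAU hAP
  have hpre : ∀ B ∈ U, Subtype.val '' (Subtype.val ⁻¹' B : Set P) ∈ U := by
    intro B hB
    rw [Subtype.image_preimage_coe]
    exact Filter.inter_mem hPU hB
  -- The closed subsets of `P` belonging to `U` form a stable family, since `A` is one of them; a
  -- common point is a limit of `U`.
  obtain ⟨p, hp⟩ := hP {F | IsClosed F ∧ Subtype.val '' F ∈ U} (fun F hF => hF.1)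
    (fun h => ⟨Subtype.val ⁻¹' A, ⟨hA.preimage continuous_subtype_val, hpre A hAU⟩, hb h⟩)
    (by
      intro T hT
      have h1 : (⋂ F ∈ T, Subtype.val '' F) ∩ P ∈ U :=
        Filter.inter_mem ((Filter.biInter_finset_mem T).2 fun F hF => (hT hF).2) hPU
      obtain ⟨y, hy, hyP⟩ := U.nonempty_of_mem h1
      refine ⟨⟨y, hyP⟩, fun F hF => ?_⟩
      obtain ⟨z, hz, hzy⟩ := mem_iInter₂.1 hy F hF
      exact (Subtype.ext hzy : z = ⟨y, hyP⟩) ▸ hz)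
  refine ⟨p, hp _ ⟨hA.preimage continuous_subtype_val, hpre A hAU⟩, ?_⟩
  refine (nhds_basis_opens (p : Y)).ge_iff.2 fun W hW => ?_
  by_contra hWU
  exact hp _ ⟨hW.2.isClosed_compl.preimage continuous_subtype_val,
    hpre _ (Ultrafilter.compl_mem_iff_notMem.2 hWU)⟩ hW.1

/-- A closed set is compact if it becomes so after the removal of any neighbourhood of a compact set. -/
theorem isCompact_of_forall_diff {H K : Set Y} (hH : IsClosed H) (hK : IsCompact K)
    (h : ∀ V, IsOpen V → K ⊆ V → IsCompact (H \ V)) : IsCompact H := by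
  classical
  refine isCompact_of_finite_subcover fun {ι} U hU hHU => ?_
  obtain ⟨s, hs⟩ := (hK.inter_right hH).elim_finite_subcover U hU (inter_subset_right.trans hHU)
  -- The finite subfamily covers only `K ∩ H`; adjoining `Hᶜ` captures all of `K` and removes
  -- nothing more from `H`.
  have hV : IsOpen ((⋃ i ∈ s, U i) ∪ Hᶜ) :=
    (isOpen_biUnion fun i _ => hU i).union hH.isOpen_compl
  obtain ⟨t, ht⟩ := (h _ hV fun x hx => by
    by_cases hxH : x ∈ H
    · exact Or.inl (hs ⟨hx, hxH⟩)
    · exact Or.inr hxH).elim_finite_subcover U hU (sdiff_subset.trans hHU)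
  refine ⟨s ∪ t, fun x hx => ?_⟩
  rw [Finset.set_biUnion_union]
  by_cases hxs : x ∈ ⋃ i ∈ s, U i
  · exact Or.inl hxs
  · exact Or.inr (ht ⟨hx, fun h => h.elim hxs fun h => h hx⟩)

/-- In a nearly pseudocompact space, a closed set that is completely separated from the complement
of a realcompact set is compact. -/
theorem NearlyPseudocompactSpace.isCompact_of_completelySeparated
    (hY : NearlyPseudocompactSpace Y) {A P : Set Y} (hA : IsClosed A) (hP : IsRealcompact P)
    (hs : CompletelySeparated A Pᶜ) : IsCompact A := by
  classical
  obtain ⟨Y₁, Y₂, hun, -, -, hps, hreg, hanti, -⟩ := hY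
  obtain ⟨g, hg, hgA, hgP⟩ := hs
  have hgc := g.continuous
  have hsub : ∀ y, g y < 1 → y ∈ P := by
    intro y hy
    by_contra h
    exact hy.ne (hgP y h)
  have hY₂ : IsClosed Y₂ := hreg ▸ isClosed_closure
  have hdisj : ∀ y, g y < 1 → y ∉ Y₂ := by
    intro y hy hy2
    -- With `g y < c < 1`, the set `{g ≤ c}` is a neighbourhood of `y` and a closed subset of `P`,
    -- so its trace on `Y₂` is realcompact.
    obtain ⟨c, hc, hc1⟩ := exists_between hy
    have hcl : IsClosed (Subtype.val ⁻¹' {z | g z ≤ c} : Set Y₂) :=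
      (isClosed_le hgc continuous_const).preimage continuous_subtype_val
    refine hanti ⟨y, hy2⟩ (Subtype.val ⁻¹' {z | g z ≤ c}) ?_ ?_
    · refine continuous_subtype_val.continuousAt.preimage_mem_nhds ?_
      exact Filter.mem_of_superset ((isOpen_lt hgc continuous_const).mem_nhds hc)
        fun z (hz : g z < c) => hz.le
    · have hemb : IsClosedEmbedding
          (fun x : (Subtype.val ⁻¹' {z | g z ≤ c} : Set Y₂) => ((x : Y₂) : Y)) :=
        hY₂.isClosedEmbedding_subtypeVal.comp hcl.isClosedEmbedding_subtypeVal
      have hmem : ∀ x : (Subtype.val ⁻¹' {z | g z ≤ c} : Set Y₂), ((x : Y₂) : Y) ∈ P :=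
        fun x => hsub _ (lt_of_le_of_lt x.2 hc1)
      exact RealcompactSpace.of_isClosedEmbedding hP
        (j := fun x : (Subtype.val ⁻¹' {z | g z ≤ c} : Set Y₂) => (⟨_, hmem x⟩ : P))
        (IsClosedEmbedding.of_comp IsEmbedding.subtypeVal hemb)
  have hY₁ : ∀ y, g y < 1 → y ∈ Y₁ := fun y hy =>
    ((eq_univ_iff_forall.1 hun y).resolve_right (hdisj y hy))
  have hlt : ∀ y, g y ≤ 1 / 2 → g y < 1 := fun y hy => by linarith
  have hA1 : ∀ y ∈ A, g y < 1 := fun y hy => by rw [hgA y hy]; norm_num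
  refine hP.isCompact_of_bounded hA (fun y hy => hsub y (hA1 y hy)) fun h => ?_
  -- The factor `1 / 2 - g` vanishes where `g = 1 / 2`, so extension by zero is continuous on `Y`;
  -- on `A`, where `g = 0`, it leaves `h / 2`.
  let k : Y → ℝ := fun y =>
    if hy : g y ≤ 1 / 2 then h ⟨y, hsub y (hlt y hy)⟩ * (1 / 2 - g y) else 0
  have hk1 : ContinuousOn k {y | g y ≤ 1 / 2} := by
    rw [continuousOn_iff_continuous_domRestrict]
    have : domRestrict {y | g y ≤ 1 / 2} k =
        fun y : {y | g y ≤ 1 / 2} => h ⟨y, hsub y (hlt y y.2)⟩ * (1 / 2 - g y) := by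
      ext y
      exact dif_pos y.2
    rw [this]
    fun_prop
  have hk2 : ContinuousOn k {y | 1 / 2 ≤ g y} := by
    refine (continuousOn_const (c := (0 : ℝ))).congr fun y hy => ?_
    by_cases hy' : g y ≤ 1 / 2
    · have : g y = 1 / 2 := le_antisymm hy' hy
      simp [k, this]
    · exact dif_neg hy'
  have hk : Continuous k := by
    rw [← continuousOn_univ]
    have := hk1.union_of_isClosed hk2 (isClosed_le hgc continuous_const)
      (isClosed_le continuous_const hgc)
    exact this.mono fun y _ => le_total (g y) (1 / 2)
  obtain ⟨M, hM⟩ := hps ⟨fun y => k y, hk.comp continuous_subtype_val⟩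
  refine ⟨2 * M, fun x hx => ?_⟩
  have h1 := hM ⟨x, hY₁ x (hA1 x hx)⟩
  have h2 : k x = h x * (1 / 2) := by
    simp [k, hgA x hx]
  simp only [ContinuousMap.coe_mk, h2, abs_mul] at h1
  rw [abs_of_pos (by norm_num : (0 : ℝ) < 1 / 2)] at h1
  linarith

/-- The hard subsets of a nearly pseudocompact space are compact. -/
theorem NearlyPseudocompactSpace.isCompact_of_isHard (hY : NearlyPseudocompactSpace Y)
    {H : Set Y} (hH : IsHard H) : IsCompact H := by
  obtain ⟨hcl, K, hK, h⟩ := hH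
  refine isCompact_of_forall_diff hcl hK fun V hV hKV => ?_
  obtain ⟨P, hP, hs⟩ := h V hV hKV
  exact hY.isCompact_of_completelySeparated (hcl.sdiff hV) hP hs

end Compactness

/-! ### Zero sets, z-ultrafilters and the topology of `δX` -/

section ZeroSets

variable {X : Type u} [TopologicalSpace X]

theorem IsZeroSet.inter {Z W : Set X} (hZ : IsZeroSet Z) (hW : IsZeroSet W) :
    IsZeroSet (Z ∩ W) := by
  obtain ⟨f, rfl⟩ := hZ
  obtain ⟨g, rfl⟩ := hW
  refine ⟨f * f + g * g, ?_⟩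
  ext x
  exact mul_self_add_mul_self_eq_zero.symm

theorem IsZeroSet.union {Z W : Set X} (hZ : IsZeroSet Z) (hW : IsZeroSet W) :
    IsZeroSet (Z ∪ W) := by
  obtain ⟨f, rfl⟩ := hZ
  obtain ⟨g, rfl⟩ := hW
  refine ⟨f * g, ?_⟩
  ext x
  exact mul_eq_zero.symm

theorem IsZeroSet.isClosed {Z : Set X} (hZ : IsZeroSet Z) : IsClosed Z := by
  obtain ⟨f, rfl⟩ := hZ
  exact isClosed_eq f.continuous continuous_const

theorem isZeroSet_le {f g : X → ℝ} (hf : Continuous f) (hg : Continuous g) :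
    IsZeroSet {x | f x ≤ g x} := by
  refine ⟨⟨fun x => max (f x - g x) 0, by fun_prop⟩, ?_⟩
  ext x
  simp

theorem IsHard.of_isClosed_subset {H G : Set X} (hH : IsHard H) (hG : IsClosed G)
    (hGH : G ⊆ H) : IsHard G := by
  obtain ⟨-, K, hK, h⟩ := hH
  refine ⟨hG, K, hK, fun V hV hKV => ?_⟩
  obtain ⟨P, hP, g, h1, h2, h3⟩ := h V hV hKV
  exact ⟨P, hP, g, h1, fun x hx => h2 x ⟨hGH hx.1, hx.2⟩, h3⟩

/-- Otherwise `p` and `Z` together generate a strictly larger z-filter. -/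
theorem IsZUltrafilter.exists_disjoint {p : Set (Set X)} (hp : IsZUltrafilter p) {Z : Set X}
    (hZ : IsZeroSet Z) (hZp : Z ∉ p) : ∃ U ∈ p, U ∩ Z = ∅ := by
  by_contra! hne
  refine hZp (hp.2 (y := {V | IsZeroSet V ∧ ∃ U ∈ p, U ∩ Z ⊆ V}) ?_ ?_
    ⟨hZ, univ, hp.1.univ_mem, inter_subset_right⟩)
  · refine ⟨fun V hV => hV.1, ⟨hp.1.isZeroSet _ hp.1.univ_mem, univ, hp.1.univ_mem,
      subset_univ _⟩, ?_, ?_, ?_⟩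
    · rintro ⟨-, U, hU, hUZ⟩
      exact (hne U hU).ne_empty (subset_empty_iff.1 hUZ)
    · rintro V ⟨hV, U, hU, hUV⟩ W ⟨hW, U', hU', hUW⟩
      exact ⟨hV.inter hW, U ∩ U', hp.1.inter_mem U hU U' hU',
        fun x hx => ⟨hUV ⟨hx.1.1, hx.2⟩, hUW ⟨hx.1.2, hx.2⟩⟩⟩
    · rintro V ⟨-, U, hU, hUV⟩ W hW hVW
      exact ⟨hW, U, hU, hUV.trans hVW⟩
  · exact fun V hV => ⟨hp.1.isZeroSet V hV, V, hV, inter_subset_left⟩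

theorem IsZUltrafilter.mem_or_mem {p : Set (Set X)} (hp : IsZUltrafilter p) {Z W : Set X}
    (hZ : IsZeroSet Z) (hW : IsZeroSet W) (h : Z ∪ W ∈ p) : Z ∈ p ∨ W ∈ p := by
  by_contra! hc
  obtain ⟨U, hU, hUZ⟩ := hp.exists_disjoint hZ hc.1
  refine hc.2 (hp.1.mem_of_superset _ (hp.1.inter_mem U hU _ h) W hW ?_)
  rintro x ⟨hxU, hxZ | hxW⟩
  · exact (eq_empty_iff_forall_notMem.1 hUZ x ⟨hxU, hxZ⟩).elim
  · exact hxW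

/-- A single hard member `H` of `p` suffices: in any z-filter `G ⊇ p` the sets `Z ∩ H` are hard,
being closed in `H`, so `G` is already an hz-filter. -/
theorem IsHzUltrafilter.isZUltrafilter {p : Set (Set X)} (hp : IsHzUltrafilter p) :
    IsZUltrafilter p := by
  refine ⟨hp.1.1, fun G hG hle => hp.2 ⟨hG, fun Z hZ => ?_⟩ hle⟩
  obtain ⟨H, hH, hHh, -⟩ := hp.1.2 univ hp.1.1.univ_mem
  have hm := hG.inter_mem _ hZ _ (hle hH)
  exact ⟨_, hm, hHh.of_isClosed_subset (hG.isZeroSet _ hm).isClosed inter_subset_right,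
    inter_subset_left⟩

namespace Delta

theorem isZUltrafilter (p : Delta X) : IsZUltrafilter p.1 :=
  p.2.elim (fun h => h.1) fun h => h.isZUltrafilter

theorem isFixed_or_exists_isHard (p : Delta X) : IsFixed p.1 ∨ ∃ H ∈ p.1, IsHard H := by
  rcases p.2 with h | h
  · exact Or.inl h.2
  · obtain ⟨H, hH, hHh, -⟩ := h.1.2 univ h.1.1.univ_mem
    exact Or.inr ⟨H, hH, hHh⟩

theorem basicClosed_union {Z W : Set X} (hZ : IsZeroSet Z) (hW : IsZeroSet W) :
    basicClosed (Z ∪ W) = basicClosed Z ∪ basicClosed W := by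
  ext p
  have hp := p.isZUltrafilter
  exact ⟨hp.mem_or_mem hZ hW, fun h => h.elim
    (fun h => hp.1.mem_of_superset _ h _ (hZ.union hW) subset_union_left)
    (fun h => hp.1.mem_of_superset _ h _ (hZ.union hW) subset_union_right)⟩

theorem isTopologicalBasis : TopologicalSpace.IsTopologicalBasis
    {U : Set (Delta X) | ∃ Z : Set X, IsZeroSet Z ∧ U = (basicClosed Z)ᶜ} where
  exists_subset_inter := by
    rintro _ ⟨Z, hZ, rfl⟩ _ ⟨W, hW, rfl⟩ p hp
    refine ⟨_, ⟨Z ∪ W, hZ.union hW, rfl⟩, ?_⟩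
    rw [basicClosed_union hZ hW, compl_union]
    exact ⟨hp, Subset.rfl⟩
  sUnion_eq := by
    refine eq_univ_of_forall fun p => ⟨_, ⟨∅, ⟨1, ?_⟩, rfl⟩, p.isZUltrafilter.1.empty_notMem⟩
    ext
    simp
  eq_generateFrom := rfl

theorem denseRange_of : DenseRange (of : X → Delta X) := by
  refine isTopologicalBasis.dense_iff.2 ?_
  rintro _ ⟨Z, hZ, rfl⟩ ⟨p, hp⟩
  obtain ⟨x, hx⟩ : ∃ x, x ∉ Z := by
    by_contra! h
    exact hp ((eq_univ_of_forall h).symm ▸ p.isZUltrafilter.1.univ_mem)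
  exact ⟨of x, fun h => hx h.2, x, rfl⟩

end Delta

end ZeroSets

/-! ### Limits along `f` and the extension to `δX` -/

section Extension

variable {X : Type u} [TopologicalSpace X] {Y : Type v} [TopologicalSpace Y]

/-- If each hard set of `X` has compact closed image, each point of `δX` has a limit in `Y`. -/
theorem Delta.exists_forall_mem_closure {f : X → Y}
    (hf : ∀ H, IsHard H → IsClosed (f '' H) ∧ IsCompact (f '' H)) (p : Delta X) :
    ∃ y, ∀ Z ∈ p.1, y ∈ closure (f '' Z) := by
  rcases p.isFixed_or_exists_isHard with ⟨x, hx⟩ | ⟨H, hH, hHh⟩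
  · exact ⟨f x, fun Z hZ => subset_closure ⟨x, hx Z hZ, rfl⟩⟩
  have hp := p.isZUltrafilter.1
  have : Nonempty p.1 := ⟨⟨H, hH⟩⟩
  -- Intersecting with `H` keeps all the closures inside the compact set `f '' H`.
  have hsub : ∀ Z : Set X, closure (f '' (Z ∩ H)) ⊆ f '' H := fun Z =>
    closure_minimal (image_mono inter_subset_right) (hf H hHh).1
  obtain ⟨y, hy⟩ := IsCompact.nonempty_iInter_of_directed_nonempty_isCompact_isClosed
    (fun Z : p.1 => closure (f '' (Z.1 ∩ H)))
    (fun Z W => ⟨⟨_, hp.inter_mem _ Z.2 _ W.2⟩,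
      closure_mono (image_mono fun x hx => ⟨hx.1.1, hx.2⟩),
      closure_mono (image_mono fun x hx => ⟨hx.1.2, hx.2⟩)⟩)
    (fun Z => by
      refine (Set.Nonempty.image f ?_).closure
      rw [nonempty_iff_ne_empty]
      intro h
      exact hp.empty_notMem (h ▸ hp.inter_mem _ Z.2 _ hH))
    (fun Z => (hf H hHh).2.of_isClosed_subset isClosed_closure (hsub Z.1))
    (fun Z => isClosed_closure)
  exact ⟨y, fun Z hZ => closure_mono (image_mono inter_subset_left) (mem_iInter.1 hy ⟨Z, hZ⟩)⟩

/-- A map that picks a limit of each point of `δX` is continuous. -/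
theorem Delta.continuous_of_forall_mem_closure [CompletelyRegularSpace Y] {f : X → Y}
    (hf : Continuous f) {F : Delta X → Y} (hF : ∀ p, ∀ Z ∈ p.1, F p ∈ closure (f '' Z)) :
    Continuous F := by
  have key : ∀ (q : Delta X) (h : Y → ℝ), Continuous h → ∀ c, {x | h (f x) ≤ c} ∈ q.1 →
      h (F q) ≤ c := by
    intro q h hh c hq
    refine closure_minimal ?_ (isClosed_le hh continuous_const) (hF q _ hq)
    rintro _ ⟨x, hx, rfl⟩
    exact hx
  have cover : ∀ (q : Delta X) (h : Y → ℝ), Continuous h → ∀ c,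
      {x | h (f x) ≤ c} ∈ q.1 ∨ {x | c ≤ h (f x)} ∈ q.1 := by
    intro q h hh c
    refine q.isZUltrafilter.mem_or_mem (isZeroSet_le (hh.comp hf) continuous_const)
      (isZeroSet_le continuous_const (hh.comp hf)) ?_
    have hu : {x | h (f x) ≤ c} ∪ {x | c ≤ h (f x)} = univ :=
      eq_univ_of_forall fun x => le_total (h (f x)) c
    exact hu.symm ▸ q.isZUltrafilter.1.univ_mem
  refine continuous_iff_continuousAt.2 fun p => (nhds_basis_opens (F p)).ge_iff.2 ?_
  rintro V ⟨hpV, hV⟩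
  obtain ⟨g, hg, hg0, hg1⟩ := CompletelyRegularSpace.completely_regular (F p) Vᶜ
    hV.isClosed_compl (fun h => h hpV)
  have hgc : Continuous fun y => (g y : ℝ) := continuous_subtype_val.comp hg
  -- Any level strictly between `g (F p) = 0` and the value `1` off `V` would do. The filters
  -- omitting this zero set form a neighbourhood of `p`; by primeness they contain `{g ∘ f ≤ 2 /
  -- 3}`, which keeps their limits in `V`.
  have hW : IsZeroSet {x | (2 / 3 : ℝ) ≤ g (f x)} :=
    isZeroSet_le continuous_const (hgc.comp hf)
  refine Filter.mem_map.2 (Filter.mem_of_superset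
    ((isTopologicalBasis.isOpen ⟨_, hW, rfl⟩).mem_nhds ?_) fun q hq => ?_)
  · intro hp
    have := key p (fun y => -(g y : ℝ)) hgc.neg (-(2 / 3)) (by simpa [basicClosed] using hp)
    simp only [hg0, Icc.coe_zero] at this
    norm_num at this
  · have h1 := key q _ hgc _ ((cover q _ hgc (2 / 3)).resolve_right hq)
    by_contra hqV
    simp only [hg1 hqV, Pi.one_apply, Icc.coe_one] at h1
    norm_num at h1

end Extension

end HardSets

theorem mainTheorem12 {X : Type*} {Y : Type*}
    [TopologicalSpace X] [T35Space X] [TopologicalSpace Y] [T35Space Y]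
    (hY : HardSets.NearlyPseudocompactSpace Y) (f : X → Y) (hf : HardSets.IsHardMap f) :
    ∃! F : HardSets.Delta X → Y,
      Continuous F ∧ ∀ x : X, F (HardSets.Delta.of x) = f x := by
  have hex := HardSets.Delta.exists_forall_mem_closure (f := f) fun H hH =>
    ⟨(hf.2 H hH).1, hY.isCompact_of_isHard (hf.2 H hH)⟩
  choose F hF using hex
  have hFc := HardSets.Delta.continuous_of_forall_mem_closure hf.1 hF
  have hFf : ∀ x : X, F (HardSets.Delta.of x) = f x := by
    intro x
    -- A limit of `A_x` can only be `f x`: a function `g` separating the two gives a zero set `{g ∘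
    -- f ≤ 0}` through `x`, forcing `g ≤ 0` at the limit.
    by_contra hne
    obtain ⟨g, hg, hg0, hg1⟩ := CompletelyRegularSpace.completely_regular (f x)
      {F (HardSets.Delta.of x)} isClosed_singleton (fun h => hne h.symm)
    have hgc : Continuous fun y => (g y : ℝ) := continuous_subtype_val.comp hg
    have hmem : F (HardSets.Delta.of x) ∈ {y | (g y : ℝ) ≤ 0} := by
      refine closure_minimal ?_ (isClosed_le hgc continuous_const)
        (hF (HardSets.Delta.of x) {z | (g (f z) : ℝ) ≤ 0}
          ⟨HardSets.isZeroSet_le (hgc.comp hf.1) continuous_const, by simp [hg0]⟩)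
      rintro _ ⟨z, hz, rfl⟩
      exact hz
    have h1 := hg1 (mem_singleton (F (HardSets.Delta.of x)))
    simp only [mem_ofPred_eq, h1, Pi.one_apply, Icc.coe_one] at hmem
    norm_num at hmem
  refine ⟨F, ⟨hFc, hFf⟩, fun G hG => HardSets.Delta.denseRange_of.equalizer hG.1 hFc ?_⟩
  funext x
  exact (hG.2 x).trans (hFf x).symm
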